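/- For a locally integrable $f:\mathbb R\to\mathbb R$ let $\|f\|_{\mathrm{BMO}}=\sup_I\frac1{|I|}\int_I|f-f_I|\,dx$, where $I$ runs over the bounded open intervals and $f_I=\frac1{|I|}\int_I f\,dx$. Let $C^1(\mathbb R)$ be the Fréchet space of continuously differentiable functions on $\mathbb R$, with the $C^1$ seminorms on compact intervals. There are absolute constants $C_6,C_7>0$ such that the following holds for every $T>0$. Let $b:[0,T]\times\mathbb R\to\mathbb R$ be in $L^1(0,T;C^1(\mathbb R))$, that is, $t\mapsto b(t,\cdot)$ is strongly measurable with values in $C^1(\mathbb R)$ and $\int_0^T\sup_{|x|\le R}\big(|b(t,x)|+|\partial_xb(t,x)|\big)\,dt<\infty$ for every $R>0$, and suppose that $$\int_0^T\|\partial_x b(t,\cdot)\|_{L^\infty(\mathbb R)}\,dt<\infty .$$ Then there is a unique flow $\phi:[0,T]\times\mathbb R\to\mathbb R$ of $$\partial_t\phi(t,x)=b(t,\phi(t,x)),\qquad \phi(0,x)=x,$$ that is, a unique $\phi$ such that for every $x\in\mathbb R$ the map $r\mapsto b(r,\phi(r,x))$ is in $L^1(0,T)$ and $\phi(t,x)=x+\int_0^t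 b(r,\phi(r,x))\,dr$ for all $t\in[0,T]$. Moreover, for each $t\in[0,T]$ the map $\phi(t,\cdot)$ is differentiable on $\mathbb R$ with $\partial_x\phi(t,x)\ne0$ for all $x$, the function $\log|\partial_x\phi(t,\cdot)|$ is locally integrable, $\int_0^t\|\partial_xb(s,\cdot)\|_{\mathrm{BMO}}\,ds<\infty$, and $$\big\|\log|\partial_x\phi(t,\cdot)|\big\|_{\mathrm{BMO}}\le C_6\left(\int_0^t\|\partial_xb(s,\cdot)\|_{\mathrm{BMO}}\,ds\right)\exp\left(C_7\int_0^t\|\partial_xb(s,\cdot)\|_{\mathrm{BMO}}\,ds\right).$$ -/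

import Mathlib

open MeasureTheory Set
open scoped ENNReal

noncomputable section

/-- The `BMO(ℝ)` seminorm, as an extended number: the supremum over all bounded open intervals
`I = (a, c)` of the mean over `I` of `|f - f_I|`, where `f_I` is the mean of `f` over `I`.
It is used for locally integrable `f`. -/
def bmoNorm (f : ℝ → ℝ) : ℝ≥0∞ :=
  ⨆ (a : ℝ) (c : ℝ) (_ : a < c),
    (∫⁻ x in Ioo a c, ‖f x - ⨍ y in Ioo a c, f y‖ₑ) / ENNReal.ofReal (c - a)

/-- `b ∈ L¹(0,T; C¹(ℝ))`, where `C¹(ℝ)` is the Fréchet space of all continuously differentiable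
functions on `ℝ` (no bound at infinity), with the `C¹` seminorms on the intervals `[-R, R]`.
This space is separable, so strong measurability of the `C¹(ℝ)`-valued map `t ↦ b t` amounts to
measurability of `t ↦ b t x` for every `x`. -/
structure MemL1C1 (T : ℝ) (b : ℝ → ℝ → ℝ) : Prop where
  aemeasurable : ∀ x : ℝ, AEMeasurable (fun t => b t x) (volume.restrict (Icc 0 T))
  contDiff : ∀ᵐ t ∂(volume.restrict (Icc 0 T)), ContDiff ℝ 1 (b t)
  lintegral_lt_top : ∀ R : ℝ,
    ∫⁻ t in Icc 0 T, (⨆ x ∈ Icc (-R) R, (‖b t x‖ₑ + ‖deriv (b t) x‖ₑ)) < ∞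

/-- `φ` is a flow of `b` on `[0,T] × ℝ`, started at time `0`: for every `x`, the map
`t ↦ b t (φ t x)` is integrable on `(0,T)` and `φ t x = x + ∫₀ᵗ b r (φ r x) dr` on `[0,T]`.
Thus `∂ₜφ = b(t,φ)`, `φ(0,x) = x`, in the sense of Carathéodory. -/
def IsFlow (T : ℝ) (b φ : ℝ → ℝ → ℝ) : Prop :=
  ∀ x : ℝ, IntervalIntegrable (fun r => b r (φ r x)) volume 0 T ∧
    ∀ t ∈ Icc 0 T, φ t x = x + ∫ r in 0..t, b r (φ r x)

end

open Filter Topology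

/-! The drift is Lipschitz in space with a time-integrable constant, so the flow exists, is unique,
and satisfies `log ∂ₓφ(t,x) = g(t,x)`, where `g(t,x) = ∫₀ᵗ ∂ₓb(s,φ(s,x)) ds`. The difficulty is a
bound that sees only the BMO norms `M(s)` of `∂ₓb(s,·)`: composition with `φ(s,·)` preserves BMO,
but with a constant depending on `φ(s,·)`. The oscillation of the composition is therefore estimated
together with that of `g`, on each interval.

Fix `(a,c)`. Let `m(s)` be the mean of `∂ₓb(s,·)` over the image interval `(φ(s,a), φ(s,c))`, and
`κ(s) = ∫₀ˢ m`. Since `m` is a difference quotient of `b`, the image interval has length `(c-a)e^κ`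
(`RegularField.flow_sub_eq`). For `y = |∂ₓb(s,φ) - m| / (16M)`, the convexity bound `y ≤ e^(y+g-κ) -
1 + κ - g` is integrated over `(a,c)`. As `e^g` is the Jacobian, the exponential term becomes an
average over the image interval, at most 4 by John–Nirenberg
(`integral_exp_abs_sub_intervalMean_le`).

With `H(s) = ∫ₐᶜ |∂ₓb(s,φ) - m| dx` this reads `H(s) ≤ 16M(s)(3(c-a) + ∫₀ˢ H)`, because `∫ₐᶜ (κ-g) ≤
∫₀ˢ H` by Fubini (`integral_abs_comp_sub_le`). Grönwall bounds `∫₀ᵗ H`, which dominates the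
oscillation of `g(t,·)` about `κ(t)`. -/

/-! ### Integrating factors and Grönwall for absolutely continuous functions. -/

/-- The exponential is Lipschitz on the bounded range of `P`. This allows integration by parts
against `exp (-∫ k)` with `k` merely integrable. -/
theorem AbsolutelyContinuousOnInterval.exp_comp {P : ℝ → ℝ} {a b : ℝ}
    (hP : AbsolutelyContinuousOnInterval P a b) :
    AbsolutelyContinuousOnInterval (fun t => Real.exp (P t)) a b := by
  obtain ⟨C, hC⟩ := hP.exists_bound
  have hlip : ∀ x y, x ≤ C → y ≤ C → dist (Real.exp x) (Real.exp y) ≤ Real.exp C * dist x y := by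
    intro x y hx hy
    have := (convex_Iic C).norm_image_sub_le_of_norm_deriv_le (f := Real.exp) (C := Real.exp C)
      (fun z _ => Real.differentiableAt_exp)
      (fun z hz => by
        rw [Real.deriv_exp, Real.norm_eq_abs, Real.abs_exp]
        exact Real.exp_le_exp.2 hz) hy hx
    simpa [dist_eq_norm] using this
  rw [absolutelyContinuousOnInterval_iff] at hP ⊢
  intro ε hε
  obtain ⟨δ, hδ, h⟩ := hP (ε / Real.exp C) (by positivity)
  refine ⟨δ, hδ, fun E hE hE' => ?_⟩
  have h1 := h E hE hE'
  calc _ ≤ ∑ i ∈ Finset.range E.1, Real.exp C * dist (P (E.2 i).1) (P (E.2 i).2) := by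
        refine Finset.sum_le_sum fun i hi => ?_
        have := hE.1 i hi
        exact hlip _ _ ((le_abs_self _).trans (hC _ this.1)) ((le_abs_self _).trans (hC _ this.2))
    _ < ε := by
        rw [← Finset.mul_sum]
        rwa [lt_div_iff₀' (Real.exp_pos C)] at h1

/-- Variation of constants for a Carathéodory primitive and an integrable coefficient. -/
theorem mul_exp_neg_integral_eq {T A : ℝ} {u h k : ℝ → ℝ}
    (hh : IntervalIntegrable h volume 0 T) (hk : IntervalIntegrable k volume 0 T)
    (hu : ∀ t ∈ Icc 0 T, u t = A + ∫ s in 0..t, h s) {t : ℝ} (ht : t ∈ Icc 0 T) :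
    u t * Real.exp (-∫ s in 0..t, k s) =
      A + ∫ s in 0..t, (h s - k s * u s) * Real.exp (-∫ r in 0..s, k r) := by
  have hsub : uIcc 0 t ⊆ uIcc 0 T := by
    rw [uIcc_of_le ht.1, uIcc_of_le (ht.1.trans ht.2)]; exact Icc_subset_Icc_right ht.2
  have hh' := hh.mono_set hsub
  have hk' := hk.mono_set hsub
  have hH := hh'.absolutelyContinuousOnInterval_intervalIntegral (c := 0) left_mem_uIcc
  have hK := (hk'.absolutelyContinuousOnInterval_intervalIntegral (c := 0) left_mem_uIcc).neg.exp_comp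
  have hU : AbsolutelyContinuousOnInterval (fun t => A + ∫ s in 0..t, h s) 0 t := by
    have hc : AbsolutelyContinuousOnInterval (fun _ : ℝ => A) 0 t :=
      ((LipschitzWith.const A).lipschitzOnWith (s := uIcc 0 t)).absolutelyContinuousOnInterval
    exact hc.add hH
  have key := hU.integral_deriv_mul_eq_sub hK
  simp only [Pi.neg_apply, intervalIntegral.integral_same, neg_zero, Real.exp_zero, mul_one,
    add_zero] at key
  rw [hu t ht, ← sub_eq_iff_eq_add', ← key]
  apply intervalIntegral.integral_congr_ae
  filter_upwards [hh'.ae_hasDerivAt_integral, hk'.ae_hasDerivAt_integral] with s h1 h2 hs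
  have hs' := uIoc_subset_uIcc hs
  have d1 := (h1 hs' 0 left_mem_uIcc).const_add A
  have d2 := (h2 hs' 0 left_mem_uIcc).neg.exp
  have e2 : deriv (fun t => Real.exp (-∫ s in 0..t, k s)) s = _ := d2.deriv
  have e1 : deriv (fun t => A + ∫ s in 0..t, h s) s = _ := d1.deriv
  rw [uIcc_of_le ht.1] at hs'
  rw [e1, e2, hu s ⟨hs'.1, hs'.2.trans ht.2⟩, Pi.neg_apply]
  ring

theorem gronwall_integral {T A : ℝ} {u h k : ℝ → ℝ}
    (hh : IntervalIntegrable h volume 0 T) (hk : IntervalIntegrable k volume 0 T)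
    (hu : ∀ t ∈ Icc 0 T, u t = A + ∫ s in 0..t, h s)
    (hle : ∀ᵐ s, s ∈ Icc 0 T → h s ≤ k s * u s) {t : ℝ} (ht : t ∈ Icc 0 T) :
    u t ≤ A * Real.exp (∫ s in 0..t, k s) := by
  have key := mul_exp_neg_integral_eq hh hk hu ht
  have : ∫ s in 0..t, (h s - k s * u s) * Real.exp (-∫ r in 0..s, k r) ≤ 0 := by
    rw [intervalIntegral.integral_of_le ht.1]
    apply setIntegral_nonpos_ae measurableSet_Ioc
    filter_upwards [hle] with s hs hs'
    have := hs ⟨hs'.1.le, hs'.2.trans ht.2⟩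
    exact mul_nonpos_of_nonpos_of_nonneg (by linarith) (Real.exp_pos _).le
  have h2 : u t * Real.exp (-∫ s in 0..t, k s) ≤ A := by linarith
  have h3 := mul_le_mul_of_nonneg_right h2 (Real.exp_pos (∫ s in 0..t, k s)).le
  rwa [mul_assoc, ← Real.exp_add, neg_add_cancel, Real.exp_zero, mul_one] at h3

theorem eq_mul_exp_of_linear_integral {T A : ℝ} {u h k : ℝ → ℝ}
    (hh : IntervalIntegrable h volume 0 T) (hk : IntervalIntegrable k volume 0 T)
    (hu : ∀ t ∈ Icc 0 T, u t = A + ∫ s in 0..t, h s)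
    (heq : ∀ s ∈ Icc 0 T, h s = k s * u s) {t : ℝ} (ht : t ∈ Icc 0 T) :
    u t = A * Real.exp (∫ s in 0..t, k s) := by
  have key := mul_exp_neg_integral_eq hh hk hu ht
  have : ∫ s in 0..t, (h s - k s * u s) * Real.exp (-∫ r in 0..s, k r) = 0 := by
    rw [intervalIntegral.integral_of_le ht.1]
    apply setIntegral_eq_zero_of_forall_eq_zero
    intro s hs
    rw [heq s ⟨hs.1.le, hs.2.trans ht.2⟩]; ring
  rw [this, add_zero] at key
  rw [← key, mul_assoc, ← Real.exp_add, neg_add_cancel, Real.exp_zero, mul_one]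

theorem integral_mul_exp_integral {T : ℝ} {k : ℝ → ℝ}
    (hk : IntervalIntegrable k volume 0 T) {t : ℝ} (ht : t ∈ Icc 0 T) :
    ∫ s in 0..t, k s * Real.exp (∫ r in 0..s, k r) = Real.exp (∫ s in 0..t, k s) - 1 := by
  -- The constant solution 1, with coefficient `-k`, makes variation of constants the fundamental
  -- theorem for `exp (∫ k)`.
  have key := mul_exp_neg_integral_eq (T := T) (A := 1) (u := fun _ => 1) (h := fun _ => 0)
    (k := fun s => - k s) (by simp) hk.neg (by simp) ht
  simp only [intervalIntegral.integral_neg, neg_neg] at key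
  simp at key
  linarith

/-! ### The John–Nirenberg inequality. -/

/-- A Calderón–Zygmund stopping argument. Halving an interval of mean at most `2M` gives halves of
mean at most `4M`. A half of mean above `2M` is stopped: `hlarge` applies, and its length is charged
to `∫ g`. The others are halved again. -/
theorem integral_exp_le_of_bisection {g : ℝ → ℝ} {M l Ψ : ℝ} (hg : Continuous g)
    (hg0 : ∀ x, 0 ≤ g x) (hM : 0 < M) (hl : 0 ≤ l) (hΨ : 0 ≤ Ψ)
    (hlarge : ∀ a c, a < c → ∫ x in a..c, g x ≤ 4 * M * (c - a) →
      ∫ x in a..c, Real.exp (l * g x) ≤ Ψ * (c - a))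
    {a c : ℝ} (hac : a < c) (hmean : ∫ x in a..c, g x ≤ 2 * M * (c - a)) :
    ∫ x in a..c, Real.exp (l * g x) ≤
      Real.exp (3 * l * M) * (c - a) + Ψ / (2 * M) * ∫ x in a..c, g x := by
  -- Uniform continuity makes the bisection finite: on an interval shorter than `δ`, `g` varies by
  -- less than `M`, so mean at most `2M` forces `g ≤ 3M`.
  obtain ⟨δ, hδ, hunif⟩ := Metric.uniformContinuousOn_iff.1
    ((isCompact_Icc (a := a) (b := c)).uniformContinuousOn_of_continuous hg.continuousOn) M hM
  have hE : Continuous fun x => Real.exp (l * g x) := by fun_prop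
  have main : ∀ n : ℕ, ∀ p q, a ≤ p → p < q → q ≤ c → q - p < 2 ^ n * δ →
      ∫ x in p..q, g x ≤ 2 * M * (q - p) →
      ∫ x in p..q, Real.exp (l * g x) ≤
        Real.exp (3 * l * M) * (q - p) + Ψ / (2 * M) * ∫ x in p..q, g x := by
    intro n
    induction n with
    | zero =>
      intro p q hp hpq hq hlen hm
      have hb : ∀ x ∈ Icc p q, g x ≤ 3 * M := by
        intro x hx
        have h1 : ∫ y in p..q, (g x - M) ≤ ∫ y in p..q, g y := by
          apply intervalIntegral.integral_mono_on hpq.le (by simp) (hg.intervalIntegrable _ _)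
          intro y hy
          have := hunif x ⟨hp.trans hx.1, hx.2.trans hq⟩ y ⟨hp.trans hy.1, hy.2.trans hq⟩ (by
            rw [Real.dist_eq, abs_lt]
            constructor <;> linarith [hx.1, hx.2, hy.1, hy.2])
          rw [Real.dist_eq, abs_lt] at this
          linarith [this.2]
        rw [intervalIntegral.integral_const, smul_eq_mul] at h1
        have h2 : (q - p) * (g x - M) ≤ (q - p) * (2 * M) := by linarith
        have := le_of_mul_le_mul_left h2 (by linarith)
        linarith
      have h1 : ∫ x in p..q, Real.exp (l * g x) ≤ ∫ x in p..q, Real.exp (3 * l * M) := by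
        apply intervalIntegral.integral_mono_on hpq.le (hE.intervalIntegrable _ _) (by simp)
        intro y hy
        apply Real.exp_le_exp.2
        nlinarith [hb y hy]
      rw [intervalIntegral.integral_const, smul_eq_mul] at h1
      have h2 : 0 ≤ ∫ x in p..q, g x :=
        intervalIntegral.integral_nonneg hpq.le fun x _ => hg0 x
      have : 0 ≤ Ψ / (2 * M) * ∫ x in p..q, g x := by positivity
      linarith
    | succ n ih =>
      intro p q hp hpq hq hlen hm
      have half : ∀ p' q', a ≤ p' → p' < q' → q' ≤ c → q' - p' < 2 ^ n * δ →
          ∫ x in p'..q', g x ≤ 4 * M * (q' - p') →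
          ∫ x in p'..q', Real.exp (l * g x) ≤
            Real.exp (3 * l * M) * (q' - p') + Ψ / (2 * M) * ∫ x in p'..q', g x := by
        intro p' q' hp' hpq' hq' hlen' hm'
        by_cases h : ∫ x in p'..q', g x ≤ 2 * M * (q' - p')
        · exact ih p' q' hp' hpq' hq' hlen' h
        · push Not at h
          have h1 := hlarge p' q' hpq' hm'
          have h2 : Ψ * (q' - p') ≤ Ψ / (2 * M) * ∫ x in p'..q', g x := by
            calc Ψ * (q' - p') = Ψ / (2 * M) * (2 * M * (q' - p')) := by field_simp
              _ ≤ _ := by gcongr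
          have h3 : 0 ≤ Real.exp (3 * l * M) * (q' - p') :=
            mul_nonneg (Real.exp_pos _).le (by linarith)
          linarith
      set m := (p + q) / 2 with hmdef
      have hpm : p < m := by rw [hmdef]; linarith
      have hmq : m < q := by rw [hmdef]; linarith
      have hlen' : q - p < 2 * (2 ^ n * δ) := by rw [pow_succ] at hlen; linarith
      have s1 := intervalIntegral.integral_add_adjacent_intervals
        (hg.intervalIntegrable p m) (hg.intervalIntegrable (μ := volume) m q)
      have s2 := intervalIntegral.integral_add_adjacent_intervals
        (hE.intervalIntegrable p m) (hE.intervalIntegrable (μ := volume) m q)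
      have n1 : 0 ≤ ∫ x in p..m, g x := intervalIntegral.integral_nonneg hpm.le fun x _ => hg0 x
      have n2 : 0 ≤ ∫ x in m..q, g x := intervalIntegral.integral_nonneg hmq.le fun x _ => hg0 x
      have e1 : m - p = (q - p) / 2 := by rw [hmdef]; ring
      have e2 : q - m = (q - p) / 2 := by rw [hmdef]; ring
      have b1 := half p m hp hpm (hmq.le.trans hq) (by linarith) (by rw [e1]; linarith)
      have b2 := half m q (hp.trans hpm.le) hmq hq (by linarith) (by rw [e2]; linarith)
      rw [e1] at b1
      rw [e2] at b2
      rw [← s1, ← s2, mul_add]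
      linarith
  obtain ⟨n, hn⟩ := pow_unbounded_of_one_lt ((c - a) / δ) (one_lt_two (α := ℝ))
  exact main n a c le_rfl hac le_rfl (by rwa [div_lt_iff₀ hδ] at hn) hmean

/-- The mean of `f` over the interval between `a` and `c`. -/
noncomputable def intervalMean (f : ℝ → ℝ) (a c : ℝ) : ℝ := (∫ x in a..c, f x) / (c - a)

theorem exp_quarter_lt : Real.exp (1 / 4) < 1.3 := by
  have h : Real.exp (1 / 4) ^ 4 < 1.3 ^ 4 := by
    rw [← Real.exp_nat_mul]
    norm_num
    linarith [Real.exp_one_lt_d9]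
  exact lt_of_pow_lt_pow_left₀ 4 (by norm_num) h

/-- The **John–Nirenberg inequality** for bounded continuous functions on the line. -/
theorem integral_exp_abs_sub_intervalMean_le {f : ℝ → ℝ} {M B : ℝ} (hf : Continuous f)
    (hB : ∀ x, |f x| ≤ B) (hM : 0 < M)
    (hosc : ∀ a c, a < c → ∫ x in a..c, |f x - intervalMean f a c| ≤ M * (c - a))
    {a c : ℝ} (hac : a < c) :
    ∫ x in a..c, Real.exp (|f x - intervalMean f a c| / (16 * M)) ≤ 4 * (c - a) := by
  -- The admissible constants, uniform over all intervals. Boundedness of `f` serves only to make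
  -- this set nonempty; the resulting constant does not depend on `B`.
  set S : Set ℝ := {Φ | 0 ≤ Φ ∧ ∀ a c, a < c →
    ∫ x in a..c, Real.exp (|f x - intervalMean f a c| / (16 * M)) ≤ Φ * (c - a)} with hS
  have hcont : ∀ k, Continuous fun x => Real.exp (|f x - k| / (16 * M)) := fun k => by fun_prop
  have hmeanle : ∀ a c, a < c → |intervalMean f a c| ≤ B := by
    intro a c hac
    have h1 := intervalIntegral.norm_integral_le_of_norm_le_const (a := a) (b := c) (f := f)
      (C := B) (fun x _ => hB x)
    rw [abs_of_pos (sub_pos.2 hac), Real.norm_eq_abs] at h1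
    rw [intervalMean, abs_div, abs_of_pos (sub_pos.2 hac), div_le_iff₀ (sub_pos.2 hac)]
    exact h1
  have hne : Real.exp (2 * B / (16 * M)) ∈ S := by
    refine ⟨(Real.exp_pos _).le, fun a c hac => ?_⟩
    have h1 : ∫ x in a..c, Real.exp (|f x - intervalMean f a c| / (16 * M)) ≤
        ∫ x in a..c, Real.exp (2 * B / (16 * M)) := by
      apply intervalIntegral.integral_mono_on hac.le ((hcont _).intervalIntegrable _ _) (by simp)
      intro x _
      have := abs_sub (f x) (intervalMean f a c)
      have := hB x
      have := hmeanle a c hac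
      gcongr
      linarith
    rw [intervalIntegral.integral_const, smul_eq_mul] at h1
    linarith
  have hbdd : BddBelow S := ⟨0, fun Φ h => h.1⟩
  -- Self-improvement: applied to the infimum, which is admissible, it gives `Φ ≤ 1.3 + 0.65 Φ`,
  -- hence `Φ ≤ 1.3 / 0.35 < 4`.
  have himp : ∀ Φ ∈ S, 1.3 + 0.65 * Φ ∈ S := by
    intro Φ hΦ
    have hΦ0 := hΦ.1
    refine ⟨by positivity, fun a c hac => ?_⟩
    set k := intervalMean f a c with hk
    have key := integral_exp_le_of_bisection (g := fun x => |f x - k|) (M := M)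
      (l := 1 / (16 * M)) (Ψ := Real.exp (1 / 4) * Φ) (by fun_prop) (fun x => abs_nonneg _) hM
      (by positivity) (by positivity) ?_ hac ?_
    · have h1 : Real.exp (3 * (1 / (16 * M)) * M) ≤ 1.3 := by
        refine le_trans (Real.exp_le_exp.2 ?_) exp_quarter_lt.le
        field_simp; norm_num
      have h2 := hosc a c hac
      have h3 : Real.exp (1 / 4) * Φ / (2 * M) * ∫ x in a..c, |f x - k| ≤
          1.3 * Φ / (2 * M) * (M * (c - a)) := by
        have := exp_quarter_lt.le
        have h0 : 0 ≤ ∫ x in a..c, |f x - k| :=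
          intervalIntegral.integral_nonneg hac.le fun x _ => abs_nonneg _
        gcongr
      have h4 : 1.3 * Φ / (2 * M) * (M * (c - a)) = 0.65 * Φ * (c - a) := by field_simp; ring
      have h5 := mul_le_mul_of_nonneg_right h1 (sub_pos.2 hac).le
      have h6 : ∀ x, |f x - k| / (16 * M) = 1 / (16 * M) * |f x - k| := fun x => by ring
      simp only [h6]
      linarith
    · intro p q hpq hm
      -- Recentring at the mean over `(p,q)` costs `4M / (16M) = 1/4` in the exponent.
      have hmk : |intervalMean f p q - k| ≤ 4 * M := by
        have h1 : intervalMean f p q - k = (∫ x in p..q, (f x - k)) / (q - p) := by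
          rw [intervalIntegral.integral_sub (hf.intervalIntegrable _ _) (by simp),
            intervalIntegral.integral_const, smul_eq_mul, intervalMean]
          field_simp [(sub_pos.2 hpq).ne']
        rw [h1, abs_div, abs_of_pos (sub_pos.2 hpq), div_le_iff₀ (sub_pos.2 hpq)]
        exact (intervalIntegral.abs_integral_le_integral_abs hpq.le).trans hm
      have h2 : ∫ x in p..q, Real.exp (1 / (16 * M) * |f x - k|) ≤
          ∫ x in p..q, Real.exp (1 / 4) * Real.exp (|f x - intervalMean f p q| / (16 * M)) := by
        apply intervalIntegral.integral_mono_on hpq.le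
          (Continuous.intervalIntegrable (by fun_prop) _ _)
          ((continuous_const.mul (hcont _)).intervalIntegrable _ _)
        intro x _
        rw [Pi.mul_apply, ← Real.exp_add]
        apply Real.exp_le_exp.2
        have h3 : |f x - k| ≤ |f x - intervalMean f p q| + 4 * M :=
          (abs_sub_le _ (intervalMean f p q) _).trans (by linarith)
        calc 1 / (16 * M) * |f x - k| ≤ 1 / (16 * M) * (|f x - intervalMean f p q| + 4 * M) := by
              gcongr
          _ = _ := by field_simp; ring
      rw [intervalIntegral.integral_const_mul] at h2
      have h3 := hΦ.2 p q hpq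
      calc _ ≤ _ := h2
        _ ≤ Real.exp (1 / 4) * (Φ * (q - p)) := by gcongr
        _ = _ := by ring
    · have := hosc a c hac
      have : 0 ≤ M * (c - a) := mul_nonneg hM.le (sub_pos.2 hac).le
      linarith
  have hinf : sInf S ∈ S := by
    refine ⟨le_csInf ⟨_, hne⟩ fun Φ h => h.1, fun a c hac => ?_⟩
    rw [← div_le_iff₀ (sub_pos.2 hac)]
    exact le_csInf ⟨_, hne⟩ fun Φ h => (div_le_iff₀ (sub_pos.2 hac)).2 (h.2 a c hac)
  have h1 := csInf_le hbdd (himp _ hinf)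
  have h2 := hinf.2 a c hac
  have h3 : sInf S ≤ 4 := by linarith
  exact h2.trans (mul_le_mul_of_nonneg_right h3 (sub_pos.2 hac).le)

/-! ### The BMO seminorm of continuous functions. -/

theorem setAverage_Ioo_eq_intervalMean (f : ℝ → ℝ) {a c : ℝ} (hac : a < c) :
    ⨍ y in Ioo a c, f y = intervalMean f a c := by
  rw [setAverage_eq, intervalMean, intervalIntegral.integral_of_le hac.le,
    integral_Ioc_eq_integral_Ioo, smul_eq_mul, measureReal_def, Real.volume_Ioo,
    ENNReal.toReal_ofReal (sub_pos.2 hac).le, div_eq_inv_mul]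

theorem lintegral_osc_eq {f : ℝ → ℝ} (hf : Continuous f) {a c : ℝ} (hac : a < c) :
    (∫⁻ x in Ioo a c, ‖f x - ⨍ y in Ioo a c, f y‖ₑ) / ENNReal.ofReal (c - a) =
      ENNReal.ofReal ((∫ x in a..c, |f x - intervalMean f a c|) / (c - a)) := by
  rw [ENNReal.ofReal_div_of_pos (sub_pos.2 hac), setAverage_Ioo_eq_intervalMean f hac,
    intervalIntegral.integral_of_le hac.le, integral_Ioc_eq_integral_Ioo,
    ofReal_integral_eq_lintegral_ofReal]
  · simp only [← Real.enorm_eq_ofReal_abs]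
  · exact ((by fun_prop : Continuous fun x => |f x - intervalMean f a c|).integrableOn_Icc).mono_set
      Ioo_subset_Icc_self
  · exact Filter.Eventually.of_forall fun x => abs_nonneg _

theorem integral_osc_le_of_bmoNorm_le {f : ℝ → ℝ} (hf : Continuous f) {M : ℝ} (hM : 0 ≤ M)
    (h : bmoNorm f ≤ ENNReal.ofReal M) {a c : ℝ} (hac : a < c) :
    ∫ x in a..c, |f x - intervalMean f a c| ≤ M * (c - a) := by
  have h1 : (∫⁻ x in Ioo a c, ‖f x - ⨍ y in Ioo a c, f y‖ₑ) / ENNReal.ofReal (c - a) ≤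
      bmoNorm f :=
    le_iSup₂_of_le a c (le_iSup_of_le hac le_rfl)
  rw [lintegral_osc_eq hf hac] at h1
  have h2 := (ENNReal.ofReal_le_ofReal_iff hM).1 (h1.trans h)
  rwa [div_le_iff₀ (sub_pos.2 hac)] at h2

/-- The mean lies within `M` of any competing centre `k`, so replacing `k` by the mean at most
doubles the bound. -/
theorem bmoNorm_le_of_forall {f : ℝ → ℝ} (hf : Continuous f) {M : ℝ}
    (h : ∀ a c, a < c → ∃ k, ∫ x in a..c, |f x - k| ≤ M * (c - a)) :
    bmoNorm f ≤ ENNReal.ofReal (2 * M) := by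
  refine iSup₂_le fun a c => iSup_le fun hac => ?_
  rw [lintegral_osc_eq hf hac]
  obtain ⟨k, hk⟩ := h a c hac
  apply ENNReal.ofReal_le_ofReal
  have hpos := sub_pos.2 hac
  rw [div_le_iff₀ hpos]
  have hmk : |intervalMean f a c - k| ≤ M := by
    have h1 : intervalMean f a c - k = (∫ x in a..c, (f x - k)) / (c - a) := by
      rw [intervalIntegral.integral_sub (hf.intervalIntegrable _ _) (by simp),
        intervalIntegral.integral_const, smul_eq_mul, intervalMean]
      field_simp
    rw [h1, abs_div, abs_of_pos hpos, div_le_iff₀ hpos]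
    exact (intervalIntegral.abs_integral_le_integral_abs hac.le).trans hk
  have h2 : ∫ x in a..c, |f x - intervalMean f a c| ≤ ∫ x in a..c, (|f x - k| + M) := by
    apply intervalIntegral.integral_mono_on hac.le
      (Continuous.intervalIntegrable (by fun_prop) _ _)
      (Continuous.intervalIntegrable (by fun_prop) _ _)
    intro x _
    have := abs_sub_le (f x) k (intervalMean f a c)
    rw [abs_sub_comm k] at this
    linarith
  rw [intervalIntegral.integral_add (Continuous.intervalIntegrable (by fun_prop) _ _) (by simp),
    intervalIntegral.integral_const, smul_eq_mul] at h2
  linarith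

theorem bmoNorm_le_of_abs_le {f : ℝ → ℝ} (hf : Continuous f) {B : ℝ} (h : ∀ x, |f x| ≤ B) :
    bmoNorm f ≤ ENNReal.ofReal (2 * B) := by
  refine bmoNorm_le_of_forall hf fun a c hac => ⟨0, ?_⟩
  have h1 : ∫ x in a..c, |f x - 0| ≤ ∫ x in a..c, B := by
    apply intervalIntegral.integral_mono_on hac.le
      (Continuous.intervalIntegrable (by fun_prop) _ _) (by simp)
    intro x _
    simpa using h x
  rw [intervalIntegral.integral_const, smul_eq_mul] at h1
  linarith

/-! ### Regular fields and their flows. -/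

theorem measurable_prod_of_continuous {F : ℝ → ℝ → ℝ} (hm : ∀ x, Measurable fun t => F t x)
    (hc : ∀ t, Continuous (F t)) : Measurable fun p : ℝ × ℝ => F p.1 p.2 :=
  (measurable_uncurry_of_continuous_of_measurable (u := fun x t => F t x) hc hm).comp
    measurable_swap

theorem measurable_deriv_prod_of_contDiff {b : ℝ → ℝ → ℝ} (hm : ∀ x, Measurable fun t => b t x)
    (hd : ∀ t, ContDiff ℝ 1 (b t)) :
    Measurable fun p : ℝ × ℝ => deriv (b p.1) p.2 := by
  have hb := measurable_prod_of_continuous hm fun t => (hd t).continuous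
  refine measurable_of_tendsto_metrizable
    (f := fun (n : ℕ) (p : ℝ × ℝ) => ((1 : ℝ) / (n + 1))⁻¹ *
      (b p.1 (p.2 + 1 / ((n : ℝ) + 1)) - b p.1 p.2)) (fun n => ?_) ?_
  · have h1 : Measurable fun p : ℝ × ℝ => b p.1 (p.2 + 1 / ((n : ℝ) + 1)) :=
      hb.comp (measurable_fst.prodMk (measurable_snd.add_const _))
    exact (h1.sub hb).const_mul _
  · rw [tendsto_pi_nhds]
    intro p
    have h := (((hd p.1).differentiable one_ne_zero) p.2).hasDerivAt.tendsto_slope_zero_right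
    have h0 : Tendsto (fun n : ℕ => (1 : ℝ) / (n + 1)) atTop (𝓝[>] 0) :=
      tendsto_nhdsWithin_iff.2 ⟨tendsto_one_div_add_atTop_nhds_zero_nat,
        Eventually.of_forall fun n => by simp only [mem_Ioi]; positivity⟩
    exact h.comp h0

/-- A vector field on the line, measurable in time, `C¹` in space, with an integrable-in-time
bound on its spatial derivative. -/
structure RegularField (b : ℝ → ℝ → ℝ) (L : ℝ → ℝ) : Prop where
  measurable : ∀ x, Measurable fun t => b t x
  contDiff : ∀ t, ContDiff ℝ 1 (b t)
  abs_deriv_le : ∀ t x, |deriv (b t) x| ≤ L t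
  integrable_bound : Integrable L
  integrable_zero : Integrable fun t => b t 0

namespace RegularField

variable {b : ℝ → ℝ → ℝ} {L : ℝ → ℝ}

theorem bound_nonneg (hb : RegularField b L) (t : ℝ) : 0 ≤ L t :=
  (abs_nonneg _).trans (hb.abs_deriv_le t 0)

theorem abs_sub_le (hb : RegularField b L) (t x y : ℝ) : |b t x - b t y| ≤ L t * |x - y| :=
  convex_univ.norm_image_sub_le_of_norm_deriv_le
    (fun z _ => ((hb.contDiff t).differentiable one_ne_zero) z)
    (fun z _ => hb.abs_deriv_le t z) (mem_univ y) (mem_univ x)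

theorem continuous_deriv (hb : RegularField b L) (t : ℝ) : Continuous (deriv (b t)) :=
  (hb.contDiff t).continuous_deriv le_rfl

theorem measurable_prod (hb : RegularField b L) : Measurable fun p : ℝ × ℝ => b p.1 p.2 :=
  measurable_prod_of_continuous hb.measurable fun t => (hb.contDiff t).continuous

theorem measurable_deriv_prod (hb : RegularField b L) :
    Measurable fun p : ℝ × ℝ => deriv (b p.1) p.2 :=
  measurable_deriv_prod_of_contDiff hb.measurable hb.contDiff

theorem measurable_comp (hb : RegularField b L) {u : ℝ → ℝ} (hu : Measurable u) :
    Measurable fun s => b s (u s) :=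
  hb.measurable_prod.comp (measurable_id.prodMk hu)

theorem measurable_deriv_comp (hb : RegularField b L) {u : ℝ → ℝ} (hu : Measurable u) :
    Measurable fun s => deriv (b s) (u s) :=
  hb.measurable_deriv_prod.comp (measurable_id.prodMk hu)

theorem intervalIntegrable_comp (hb : RegularField b L) {u : ℝ → ℝ} (hu : Continuous u)
    (p q : ℝ) : IntervalIntegrable (fun s => b s (u s)) volume p q := by
  have h1 : IntervalIntegrable (fun s => |b s 0| + L s * |u s|) volume p q :=
    (hb.integrable_zero.abs.intervalIntegrable).add
      ((hb.integrable_bound.intervalIntegrable).mul_continuousOn hu.abs.continuousOn)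
  refine h1.mono_fun (hb.measurable_comp hu.measurable).aestronglyMeasurable
    (Eventually.of_forall fun s => ?_)
  have h2 := hb.abs_sub_le s (u s) 0
  rw [sub_zero] at h2
  have h3 := abs_sub_abs_le_abs_sub (b s (u s)) (b s 0)
  simp only [Real.norm_eq_abs]
  exact le_trans (by linarith) (le_abs_self _)

theorem intervalIntegrable_deriv_comp (hb : RegularField b L) {u : ℝ → ℝ} (hu : Measurable u)
    (p q : ℝ) : IntervalIntegrable (fun s => deriv (b s) (u s)) volume p q := by
  refine hb.integrable_bound.intervalIntegrable.mono_fun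
    (hb.measurable_deriv_comp hu).aestronglyMeasurable (Eventually.of_forall fun s => ?_)
  simp only [Real.norm_eq_abs]
  exact (hb.abs_deriv_le _ _).trans (le_abs_self _)

theorem exists_solution (hb : RegularField b L) {T : ℝ} (hT : 0 < T) (x : ℝ) :
    ∃ u : ℝ → ℝ, Continuous u ∧ ∀ t ∈ Icc 0 T, u t = x + ∫ s in 0..t, b s (u s) := by
  -- Weighting trajectories by `exp (-Λ)`, with twice the Lipschitz constant in `Λ`, makes the
  -- Picard map a `1/2`-contraction on all of `[0,T]` at once.
  set Λ : ℝ → ℝ := fun t => ∫ s in 0..t, 2 * L s with hΛ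
  have hL2 : ∀ p q, IntervalIntegrable (fun s => 2 * L s) volume p q := fun p q =>
    (hb.integrable_bound.const_mul 2).intervalIntegrable
  have hΛc : Continuous Λ := intervalIntegral.continuous_primitive hL2 0
  let ext : C(Icc 0 T, ℝ) → ℝ → ℝ := fun w s => Real.exp (Λ s) * w (projIcc 0 T hT.le s)
  have hext : ∀ w, Continuous (ext w) := fun w =>
    (Real.continuous_exp.comp hΛc).mul (w.continuous.comp continuous_projIcc)
  have hprim : ∀ w, Continuous fun t => ∫ s in 0..t, b s (ext w s) := fun w =>
    intervalIntegral.continuous_primitive (fun p q => hb.intervalIntegrable_comp (hext w) p q) 0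
  let F : C(Icc 0 T, ℝ) → C(Icc 0 T, ℝ) := fun w =>
    ⟨fun t => Real.exp (-Λ t) * (x + ∫ s in 0..(t : ℝ), b s (ext w s)),
      ((Real.continuous_exp.comp hΛc.neg).mul (continuous_const.add (hprim w))).comp
        continuous_subtype_val⟩
  have hF : ContractingWith (1 / 2) F := by
    refine ⟨by rw [← NNReal.coe_lt_coe]; norm_num, LipschitzWith.of_dist_le_mul fun w v => ?_⟩
    have hC : 0 ≤ ((1 / 2 : NNReal) : ℝ) * dist w v := by positivity
    refine (ContinuousMap.dist_le hC).2 fun t => ?_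
    have ht := t.2
    have hd : ∀ s ∈ Icc 0 (t : ℝ), |b s (ext w s) - b s (ext v s)| ≤
        2 * L s * Real.exp (Λ s) * (dist w v / 2) := by
      intro s hs
      have h1 := hb.abs_sub_le s (ext w s) (ext v s)
      have h2 : |ext w s - ext v s| ≤ Real.exp (Λ s) * dist w v := by
        rw [← mul_sub, abs_mul, Real.abs_exp]
        exact mul_le_mul_of_nonneg_left
          (ContinuousMap.dist_apply_le_dist (f := w) (g := v) _) (Real.exp_pos _).le
      calc _ ≤ _ := h1
        _ ≤ L s * (Real.exp (Λ s) * dist w v) := by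
            have := hb.bound_nonneg s
            gcongr
        _ = _ := by ring
    have hi : ∀ w, IntervalIntegrable (fun s => b s (ext w s)) volume 0 t := fun w =>
      hb.intervalIntegrable_comp (hext w) _ _
    have h3 : |(∫ s in 0..(t : ℝ), b s (ext w s)) - ∫ s in 0..(t : ℝ), b s (ext v s)| ≤
        (Real.exp (Λ t) - 1) * (dist w v / 2) := by
      rw [← intervalIntegral.integral_sub (hi w) (hi v),
        ← integral_mul_exp_integral (hL2 0 T) ht, ← intervalIntegral.integral_mul_const]
      refine (intervalIntegral.abs_integral_le_integral_abs ht.1).trans ?_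
      exact intervalIntegral.integral_mono_on ht.1 ((hi w).sub (hi v)).abs
        (((hL2 0 t).mul_continuousOn (Real.continuous_exp.comp hΛc).continuousOn).mul_const _) hd
    have h4 : Real.exp (-Λ t) * Real.exp (Λ t) = 1 := by rw [← Real.exp_add]; simp
    have h5 : F w t - F v t = Real.exp (-Λ t) *
        ((∫ s in 0..(t : ℝ), b s (ext w s)) - ∫ s in 0..(t : ℝ), b s (ext v s)) := by
      simp only [F, ContinuousMap.coe_mk]; ring
    rw [Real.dist_eq, h5, abs_mul, Real.abs_exp]
    have h6 : 0 ≤ Real.exp (-Λ t) * (dist w v / 2) := by positivity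
    calc _ ≤ Real.exp (-Λ t) * ((Real.exp (Λ t) - 1) * (dist w v / 2)) := by gcongr
      _ = (Real.exp (-Λ t) * Real.exp (Λ t)) * (dist w v / 2) -
          Real.exp (-Λ t) * (dist w v / 2) := by ring
      _ ≤ (1 / 2 : ℝ) * dist w v := by rw [h4]; linarith
      _ = _ := by norm_num
  obtain ⟨w, hw, -⟩ := hF.exists_fixedPoint 0 (edist_ne_top _ _)
  refine ⟨ext w, hext w, fun t ht => ?_⟩
  have h1 : F w ⟨t, ht⟩ = w ⟨t, ht⟩ := by rw [hw]
  have h2 : ext w t = Real.exp (Λ t) * w ⟨t, ht⟩ := by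
    simp only [ext]; rw [projIcc_of_mem hT.le ht]
  rw [h2, ← h1]
  simp only [F, ContinuousMap.coe_mk]
  rw [← mul_assoc, ← Real.exp_add]
  simp

end RegularField

theorem IsFlow.continuousOn {T : ℝ} {b φ : ℝ → ℝ → ℝ} (hT : 0 ≤ T) (h : IsFlow T b φ) (x : ℝ) :
    ContinuousOn (fun t => φ t x) (Icc 0 T) := by
  have h1 := (h x).1.absolutelyContinuousOnInterval_intervalIntegral (c := 0) left_mem_uIcc
  have h2 := h1.continuousOn
  rw [uIcc_of_le hT] at h2
  exact (continuousOn_const.add h2).congr fun t ht => (h x).2 t ht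

namespace RegularField

variable {b φ : ℝ → ℝ → ℝ} {L : ℝ → ℝ} {T : ℝ}

theorem isFlow_unique (hb : RegularField b L) (hT : 0 ≤ T) {ψ : ℝ → ℝ → ℝ} (hφ : IsFlow T b φ)
    (hψ : IsFlow T b ψ) {t : ℝ} (ht : t ∈ Icc 0 T) (x : ℝ) : ψ t x = φ t x := by
  have hv : ContinuousOn (fun s => |ψ s x - φ s x|) (uIcc 0 T) := by
    rw [uIcc_of_le hT]
    exact ((hψ.continuousOn hT x).sub (hφ.continuousOn hT x)).abs
  have hLv : IntervalIntegrable (fun s => L s * |ψ s x - φ s x|) volume 0 T :=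
    hb.integrable_bound.intervalIntegrable.mul_continuousOn hv
  have hle : ∀ t ∈ Icc 0 T, |ψ t x - φ t x| ≤ ∫ s in 0..t, L s * |ψ s x - φ s x| := by
    intro t ht
    have hsub : uIcc 0 t ⊆ uIcc 0 T := by
      rw [uIcc_of_le ht.1, uIcc_of_le hT]; exact Icc_subset_Icc_right ht.2
    have i1 := (hψ x).1.mono_set hsub
    have i2 := (hφ x).1.mono_set hsub
    rw [(hψ x).2 t ht, (hφ x).2 t ht, add_sub_add_left_eq_sub,
      ← intervalIntegral.integral_sub i1 i2]
    refine (intervalIntegral.abs_integral_le_integral_abs ht.1).trans ?_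
    exact intervalIntegral.integral_mono_on ht.1 (i1.sub i2).abs (hLv.mono_set hsub)
      fun s _ => hb.abs_sub_le _ _ _
  have key := gronwall_integral (A := 0) hLv (k := L) hb.integrable_bound.intervalIntegrable
    (u := fun t => ∫ s in 0..t, L s * |ψ s x - φ s x|) (fun t _ => by simp)
    (Eventually.of_forall fun s hs =>
      mul_le_mul_of_nonneg_left (hle s hs) (hb.bound_nonneg s)) ht
  rw [zero_mul] at key
  have := (hle t ht).trans key
  exact sub_eq_zero.1 (abs_nonpos_iff.1 this)

theorem abs_div_le (hb : RegularField b L) (s x y : ℝ) :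
    |(b s y - b s x) / (y - x)| ≤ L s := by
  rcases eq_or_ne y x with rfl | h
  · simpa using hb.bound_nonneg s
  · rw [abs_div, div_le_iff₀ (abs_pos.2 (sub_ne_zero.2 h))]
    exact hb.abs_sub_le _ _ _

theorem measurable_slope (hb : RegularField b L) (hc : ∀ x, Continuous fun t => φ t x) (x y : ℝ) :
    Measurable fun s => (b s (φ s y) - b s (φ s x)) / (φ s y - φ s x) :=
  ((hb.measurable_comp (hc y).measurable).sub (hb.measurable_comp (hc x).measurable)).div
    ((hc y).measurable.sub (hc x).measurable)

theorem intervalIntegrable_slope (hb : RegularField b L) (hc : ∀ x, Continuous fun t => φ t x)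
    (x y p q : ℝ) :
    IntervalIntegrable (fun s => (b s (φ s y) - b s (φ s x)) / (φ s y - φ s x)) volume p q := by
  refine hb.integrable_bound.intervalIntegrable.mono_fun
    (hb.measurable_slope hc x y).aestronglyMeasurable (Eventually.of_forall fun s => ?_)
  simp only [Real.norm_eq_abs]
  exact (hb.abs_div_le _ _ _).trans (le_abs_self _)

/-- The difference of two trajectories solves a linear equation whose coefficient is the difference
quotient of `b`. Monotonicity, the Lipschitz bound and the spatial derivative of the flow all follow
from this formula. -/
theorem flow_sub_eq (hb : RegularField b L) (hc : ∀ x, Continuous fun t => φ t x)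
    (hφ : IsFlow T b φ) (x y : ℝ) {t : ℝ} (ht : t ∈ Icc 0 T) :
    φ t y - φ t x =
      (y - x) * Real.exp (∫ s in 0..t, (b s (φ s y) - b s (φ s x)) / (φ s y - φ s x)) := by
  have hi : ∀ x p q, IntervalIntegrable (fun s => b s (φ s x)) volume p q :=
    fun x p q => hb.intervalIntegrable_comp (hc x) p q
  refine eq_mul_exp_of_linear_integral (u := fun t => φ t y - φ t x)
    ((hi y 0 T).sub (hi x 0 T)) (hb.intervalIntegrable_slope hc x y 0 T) ?_ ?_ ht
  · intro t ht
    rw [intervalIntegral.integral_sub (hi y 0 t) (hi x 0 t), (hφ y).2 t ht, (hφ x).2 t ht]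
    ring
  · intro s hs
    -- If the trajectories met, the quotient would be `0` by convention and both sides would vanish.
    rcases eq_or_ne (φ s y) (φ s x) with h | h
    · simp [h]
    · field_simp [sub_ne_zero.2 h]

theorem flow_strictMono (hb : RegularField b L) (hc : ∀ x, Continuous fun t => φ t x)
    (hφ : IsFlow T b φ) {t : ℝ} (ht : t ∈ Icc 0 T) : StrictMono (φ t) := by
  intro x y hxy
  rw [← sub_pos, hb.flow_sub_eq hc hφ x y ht]
  exact mul_pos (sub_pos.2 hxy) (Real.exp_pos _)

theorem continuous_flow (hb : RegularField b L) (hc : ∀ x, Continuous fun t => φ t x)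
    (hφ : IsFlow T b φ) {t : ℝ} (ht : t ∈ Icc 0 T) : Continuous (φ t) := by
  refine (LipschitzWith.of_dist_le_mul
    (K := ⟨Real.exp (∫ s in 0..t, L s), (Real.exp_pos _).le⟩) fun y x => ?_).continuous
  rw [Real.dist_eq, Real.dist_eq, hb.flow_sub_eq hc hφ x y ht, abs_mul, Real.abs_exp, mul_comm]
  refine mul_le_mul_of_nonneg_right (Real.exp_le_exp.2 ?_) (abs_nonneg _)
  refine intervalIntegral.integral_mono_on ht.1 (hb.intervalIntegrable_slope hc x y _ _)
    hb.integrable_bound.intervalIntegrable fun s _ => ?_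
  exact (le_abs_self _).trans (hb.abs_div_le _ _ _)

theorem hasDerivAt_flow (hb : RegularField b L) (hc : ∀ x, Continuous fun t => φ t x)
    (hφ : IsFlow T b φ) {t : ℝ} (ht : t ∈ Icc 0 T) (x : ℝ) :
    HasDerivAt (φ t) (Real.exp (∫ s in 0..t, deriv (b s) (φ s x))) x := by
  rw [hasDerivAt_iff_tendsto_slope]
  have h1 : Tendsto (fun y => Real.exp
      (∫ s in 0..t, (b s (φ s y) - b s (φ s x)) / (φ s y - φ s x))) (𝓝[≠] x)
      (𝓝 (Real.exp (∫ s in 0..t, deriv (b s) (φ s x)))) := by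
    refine (Real.continuous_exp.tendsto _).comp ?_
    refine intervalIntegral.tendsto_integral_filter_of_dominated_convergence L
      (Eventually.of_forall fun y => (hb.measurable_slope hc x y).aestronglyMeasurable)
      (Eventually.of_forall fun y => Eventually.of_forall fun s _ => hb.abs_div_le _ _ _)
      hb.integrable_bound.intervalIntegrable (Eventually.of_forall fun s hs => ?_)
    rw [uIoc_of_le ht.1] at hs
    have hs' : s ∈ Icc 0 T := ⟨hs.1.le, hs.2.trans ht.2⟩
    have h2 : Tendsto (φ s) (𝓝[≠] x) (𝓝[≠] (φ s x)) :=
      ((hb.continuous_flow hc hφ hs').tendsto x).mono_left nhdsWithin_le_nhds |>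
        fun h => tendsto_nhdsWithin_iff.2 ⟨h, eventually_mem_nhdsWithin.mono fun y hy =>
          (hb.flow_strictMono hc hφ hs').injective.ne hy⟩
    have h3 := (hasDerivAt_iff_tendsto_slope.1
      (((hb.contDiff s).differentiable one_ne_zero) (φ s x)).hasDerivAt).comp h2
    refine h3.congr fun y => ?_
    simp [slope_def_field]
  refine h1.congr' (eventually_mem_nhdsWithin.mono fun y hy => ?_)
  rw [slope_def_field, hb.flow_sub_eq hc hφ x y ht, mul_div_cancel_left₀ _ (sub_ne_zero.2 hy)]

theorem continuous_log_deriv_flow (hb : RegularField b L) (hc : ∀ x, Continuous fun t => φ t x)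
    (hφ : IsFlow T b φ) {t : ℝ} (ht : t ∈ Icc 0 T) :
    Continuous fun x => ∫ s in 0..t, deriv (b s) (φ s x) := by
  rw [continuous_iff_continuousAt]
  intro x
  refine intervalIntegral.tendsto_integral_filter_of_dominated_convergence L
      (Eventually.of_forall fun y =>
        (hb.measurable_deriv_comp (hc y).measurable).aestronglyMeasurable)
      (Eventually.of_forall fun y => Eventually.of_forall fun s _ => hb.abs_deriv_le _ _)
      hb.integrable_bound.intervalIntegrable (Eventually.of_forall fun s hs => ?_)
  rw [uIoc_of_le ht.1] at hs
  exact ((hb.continuous_deriv s).comp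
    (hb.continuous_flow hc hφ ⟨hs.1.le, hs.2.trans ht.2⟩)).tendsto x

theorem exists_isFlow (hb : RegularField b L) (hT : 0 < T) :
    ∃ φ : ℝ → ℝ → ℝ, IsFlow T b φ ∧ (∀ x, Continuous fun t => φ t x) ∧ ∀ t, Continuous (φ t) := by
  choose u hu hsol using hb.exists_solution hT
  have hflow : IsFlow T b fun t x => u x t :=
    fun x => ⟨hb.intervalIntegrable_comp (hu x) _ _, hsol x⟩
  -- Freezing time outside `[0,T]` gives continuity in `x` for every real `t`, used later for joint
  -- measurability.
  have hc : ∀ x, Continuous fun t => u x (projIcc 0 T hT.le t) := fun x =>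
    (hu x).comp (continuous_subtype_val.comp continuous_projIcc)
  refine ⟨fun t x => u x (projIcc 0 T hT.le t),
    fun x => ⟨hb.intervalIntegrable_comp (hc x) _ _, fun t ht => ?_⟩, hc,
    fun t => hb.continuous_flow hu hflow (projIcc 0 T hT.le t).2⟩
  simp only [projIcc_of_mem hT.le ht]
  rw [hsol x t ht]
  congr 1
  refine intervalIntegral.integral_congr fun s hs => ?_
  rw [uIcc_of_le ht.1] at hs
  simp only [projIcc_of_mem hT.le (⟨hs.1, hs.2.trans ht.2⟩ : s ∈ Icc 0 T)]

end RegularField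

/-! ### The BMO estimate for the logarithm of the Jacobian. -/

/-- Oscillation of a composition, bounded through John–Nirenberg and the entropy of the
Jacobian `exp g` of the change of variables. -/
theorem integral_abs_comp_sub_le {f θ g : ℝ → ℝ} {M B a c κ : ℝ} (hf : Continuous f)
    (hB : ∀ x, |f x| ≤ B) (hM : 0 ≤ M)
    (hosc : ∀ a c, a < c → ∫ x in a..c, |f x - intervalMean f a c| ≤ M * (c - a))
    (hg : Continuous g) (hθ : ∀ x, HasDerivAt θ (Real.exp (g x)) x) (hac : a < c)
    (hκ : θ c - θ a = (c - a) * Real.exp κ) :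
    ∫ x in a..c, |f (θ x) - intervalMean f (θ a) (θ c)| ≤
      16 * M * (3 * (c - a) + ∫ x in a..c, (κ - g x)) := by
  have hθc : Continuous θ := continuous_iff_continuousAt.2 fun x => (hθ x).continuousAt
  have hlt : θ a < θ c := by
    rw [← sub_pos, hκ]; exact mul_pos (sub_pos.2 hac) (Real.exp_pos _)
  set m := intervalMean f (θ a) (θ c) with hm
  -- `M` may vanish, so the argument divides by some `N > M` and then lets `N` decrease to `M`.
  have pos : ∀ N, M < N → ∫ x in a..c, |f (θ x) - m| ≤
      16 * N * (3 * (c - a) + ∫ x in a..c, (κ - g x)) := by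
    intro N hMN
    have hN : 0 < N := hM.trans_lt hMN
    have jn := integral_exp_abs_sub_intervalMean_le hf hB hN (fun a c hac => (hosc a c hac).trans
      (mul_le_mul_of_nonneg_right hMN.le (sub_pos.2 hac).le)) hlt
    rw [← hm] at jn
    have hE : Continuous fun y => Real.exp (|f y - m| / (16 * N)) := by fun_prop
    have cv := intervalIntegral.integral_comp_mul_deriv (a := a) (b := c) (f := θ)
      (f' := fun x => Real.exp (g x)) (g := fun y => Real.exp (|f y - m| / (16 * N)))
      (fun x _ => hθ x) (by fun_prop) hE
    have hle : ∫ x in a..c, |f (θ x) - m| / (16 * N) ≤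
        ∫ x in a..c, (Real.exp (-κ) *
          (((fun y => Real.exp (|f y - m| / (16 * N))) ∘ θ) x * Real.exp (g x)) + -1 +
            (κ - g x)) := by
      apply intervalIntegral.integral_mono_on hac.le
        (Continuous.intervalIntegrable (by fun_prop) _ _)
        (Continuous.intervalIntegrable (by fun_prop) _ _)
      intro x _
      -- The entropy inequality in pointwise form: `z + 1 ≤ e^z` at `z = y + g - κ`.
      have h1 := Real.add_one_le_exp (|f (θ x) - m| / (16 * N) + g x - κ)
      have h2 : Real.exp (|f (θ x) - m| / (16 * N) + g x - κ) =
          Real.exp (-κ) * (Real.exp (|f (θ x) - m| / (16 * N)) * Real.exp (g x)) := by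
        rw [← Real.exp_add, ← Real.exp_add]; congr 1; ring
      simp only [Function.comp_apply]
      linarith
    rw [intervalIntegral.integral_add (Continuous.intervalIntegrable (by fun_prop) _ _)
        (Continuous.intervalIntegrable (by fun_prop) _ _),
      intervalIntegral.integral_add (Continuous.intervalIntegrable (by fun_prop) _ _)
        (by simp),
      intervalIntegral.integral_const_mul, cv, intervalIntegral.integral_div,
      intervalIntegral.integral_const, smul_eq_mul, hκ] at *
    have h3 : Real.exp (-κ) * ∫ x in θ a..θ c, Real.exp (|f x - m| / (16 * N)) ≤
        4 * (c - a) := by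
      calc _ ≤ Real.exp (-κ) * (4 * ((c - a) * Real.exp κ)) := by gcongr
        _ = 4 * (c - a) * (Real.exp (-κ) * Real.exp κ) := by ring
        _ = _ := by rw [← Real.exp_add]; simp
    rw [div_le_iff₀ (by positivity)] at hle
    refine hle.trans ?_
    rw [mul_comm]
    gcongr
    linarith
  have hlim : Tendsto (fun N => 16 * N * (3 * (c - a) + ∫ x in a..c, (κ - g x))) (𝓝[>] M)
      (𝓝 (16 * M * (3 * (c - a) + ∫ x in a..c, (κ - g x)))) :=
    ((by fun_prop : Continuous fun N : ℝ =>
      16 * N * (3 * (c - a) + ∫ x in a..c, (κ - g x))).tendsto M).mono_left nhdsWithin_le_nhds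
  exact ge_of_tendsto hlim (eventually_mem_nhdsWithin.mono fun N hN => pos N hN)

namespace RegularField

variable {b φ : ℝ → ℝ → ℝ} {L M : ℝ → ℝ} {T : ℝ}

theorem intervalMean_deriv (hb : RegularField b L) (s x y : ℝ) :
    intervalMean (deriv (b s)) x y = (b s y - b s x) / (y - x) := by
  rw [intervalMean, intervalIntegral.integral_deriv_eq_sub
    (fun z _ => ((hb.contDiff s).differentiable one_ne_zero) z)
    ((hb.continuous_deriv s).intervalIntegrable _ _)]

theorem integral_abs_log_deriv_flow_sub_le (hb : RegularField b L) (hφ : IsFlow T b φ)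
    (hc : ∀ x, Continuous fun t => φ t x) (hx : ∀ t, Continuous (φ t))
    (hM0 : ∀ s, 0 ≤ M s) (hM : Integrable M)
    (hbmo : ∀ s, bmoNorm (deriv (b s)) ≤ ENNReal.ofReal (M s)) {t : ℝ} (ht : t ∈ Icc 0 T)
    {a c : ℝ} (hac : a < c) :
    ∃ κ, ∫ x in a..c, |(∫ s in 0..t, deriv (b s) (φ s x)) - κ| ≤
      48 * (∫ s in 0..t, M s) * Real.exp (16 * ∫ s in 0..t, M s) * (c - a) := by
  set m : ℝ → ℝ := fun s => (b s (φ s c) - b s (φ s a)) / (φ s c - φ s a) with hm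
  have hmm : Measurable m := hb.measurable_slope hc a c
  have hφm : Measurable fun p : ℝ × ℝ => φ p.1 p.2 :=
    measurable_prod_of_continuous (fun x => (hc x).measurable) hx
  set G : ℝ → ℝ → ℝ := fun s x => deriv (b s) (φ s x) - m s with hG
  have hGm : Measurable (Function.uncurry G) :=
    (hb.measurable_deriv_prod.comp (measurable_fst.prodMk hφm)).sub (hmm.comp measurable_fst)
  have hGle : ∀ s x, |G s x| ≤ 2 * L s := by
    intro s x
    have := abs_sub (deriv (b s) (φ s x)) (m s)
    have := hb.abs_deriv_le s (φ s x)
    have := hb.abs_div_le s (φ s a) (φ s c)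
    simp only [hG]
    linarith
  have hGi : ∀ r ∈ Icc 0 T, Integrable (Function.uncurry fun s x => |G s x|)
      ((volume.restrict (Ioc 0 r)).prod (volume.restrict (Ioc a c))) := by
    intro r _
    have h1 : Integrable (fun p : ℝ × ℝ => 2 * L p.1)
        ((volume.restrict (Ioc 0 r)).prod (volume.restrict (Ioc a c))) :=
      (hb.integrable_bound.restrict.const_mul 2).comp_fst _
    exact h1.mono' hGm.abs.aestronglyMeasurable (Eventually.of_forall fun p => by
      simpa [Function.uncurry] using hGle p.1 p.2)
  set H : ℝ → ℝ := fun s => ∫ x in a..c, |G s x| with hH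
  have hHi : ∀ r ∈ Icc 0 T, IntervalIntegrable H volume 0 r := by
    intro r hr
    rw [intervalIntegrable_iff_integrableOn_Ioc_of_le hr.1]
    have := (hGi r hr).integral_prod_left
    simpa only [hH, intervalIntegral.integral_of_le hac.le, Function.uncurry_apply_pair,
      IntegrableOn] using this
  have hFub : ∀ r ∈ Icc 0 T,
      ∫ x in a..c, |∫ s in 0..r, G s x| ≤ ∫ s in 0..r, H s := by
    intro r hr
    have h1 : ∫ s in 0..r, H s = ∫ x in a..c, ∫ s in 0..r, |G s x| := by
      simp only [hH, intervalIntegral.integral_of_le hac.le, intervalIntegral.integral_of_le hr.1]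
      exact integral_integral_swap (hGi r hr)
    rw [h1]
    have hcont : Continuous fun x => ∫ s in 0..r, G s x := by
      have : (fun x => ∫ s in 0..r, G s x) = fun x =>
          (∫ s in 0..r, deriv (b s) (φ s x)) - ∫ s in 0..r, m s := by
        ext x
        exact intervalIntegral.integral_sub
          (hb.intervalIntegrable_deriv_comp (hc x).measurable _ _)
          (hb.intervalIntegrable_slope hc a c _ _)
      rw [this]
      exact (hb.continuous_log_deriv_flow hc hφ hr).sub continuous_const
    apply intervalIntegral.integral_mono_on hac.le (hcont.abs.intervalIntegrable _ _)
    · rw [intervalIntegrable_iff_integrableOn_Ioc_of_le hac.le]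
      have := (hGi r hr).integral_prod_right
      simpa only [intervalIntegral.integral_of_le hr.1, Function.uncurry_apply_pair,
        IntegrableOn] using this
    · intro x _
      exact intervalIntegral.abs_integral_le_integral_abs hr.1
  have hdiff : ∀ r ∈ Icc 0 T, ∀ x,
      ∫ s in 0..r, G s x = (∫ s in 0..r, deriv (b s) (φ s x)) - ∫ s in 0..r, m s := by
    intro r _ x
    exact intervalIntegral.integral_sub (hb.intervalIntegrable_deriv_comp (hc x).measurable _ _)
      (hb.intervalIntegrable_slope hc a c _ _)
  -- The loop closes here: the entropy term at time `s` is controlled by the oscillation accumulated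
  -- before `s`.
  have hHle : ∀ s ∈ Icc 0 T, H s ≤ 16 * M s * (3 * (c - a) + ∫ r in 0..s, H r) := by
    intro s hs
    have h1 := integral_abs_comp_sub_le (hb.continuous_deriv s) (hb.abs_deriv_le s) (hM0 s)
      (fun a c hac => integral_osc_le_of_bmoNorm_le (hb.continuous_deriv s) (hM0 s) (hbmo s) hac)
      (hb.continuous_log_deriv_flow hc hφ hs) (hb.hasDerivAt_flow hc hφ hs) hac
      (hb.flow_sub_eq hc hφ a c hs)
    rw [hb.intervalMean_deriv] at h1
    refine h1.trans ?_
    have h0 := hM0 s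
    gcongr
    refine le_trans (le_abs_self _) (le_trans ?_ (hFub s hs))
    refine (intervalIntegral.abs_integral_le_integral_abs hac.le).trans (le_of_eq ?_)
    refine intervalIntegral.integral_congr fun x _ => ?_
    simp only [hdiff s hs x]
    exact abs_sub_comm _ _
  have gr := gronwall_integral (A := 3 * (c - a)) (u := fun t => 3 * (c - a) + ∫ r in 0..t, H r)
    (h := H) (k := fun s => 16 * M s) (hHi T ⟨ht.1.trans ht.2, le_rfl⟩)
    (hM.const_mul 16).intervalIntegrable (fun _ _ => rfl) (Eventually.of_forall hHle) ht
  rw [intervalIntegral.integral_const_mul] at gr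
  refine ⟨∫ s in 0..t, m s, ?_⟩
  have h1 : ∫ x in a..c, |(∫ s in 0..t, deriv (b s) (φ s x)) - ∫ s in 0..t, m s| ≤
      ∫ s in 0..t, H s := by
    refine le_trans (le_of_eq ?_) (hFub t ht)
    refine intervalIntegral.integral_congr fun x _ => ?_
    simp only [hdiff t ht x]
  refine h1.trans ?_
  set B := ∫ s in 0..t, M s
  -- This keeps a factor `B` in the bound, so that it vanishes with `B`; the constant is `48 = 3 ·
  -- 16`.
  have h2 : Real.exp (16 * B) - 1 ≤ 16 * B * Real.exp (16 * B) := by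
    have h3 := Real.add_one_le_exp (-(16 * B))
    have h4 : Real.exp (-(16 * B)) * Real.exp (16 * B) = 1 := by rw [← Real.exp_add]; simp
    nlinarith [Real.exp_pos (16 * B)]
  have h5 := mul_le_mul_of_nonneg_left h2 (mul_pos three_pos (sub_pos.2 hac)).le
  linarith

theorem bmoNorm_log_deriv_flow_le (hb : RegularField b L) (hφ : IsFlow T b φ)
    (hc : ∀ x, Continuous fun t => φ t x) (hx : ∀ t, Continuous (φ t))
    (hM0 : ∀ s, 0 ≤ M s) (hM : Integrable M)
    (hbmo : ∀ s, bmoNorm (deriv (b s)) ≤ ENNReal.ofReal (M s)) {t : ℝ} (ht : t ∈ Icc 0 T) :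
    bmoNorm (fun x => ∫ s in 0..t, deriv (b s) (φ s x)) ≤ ENNReal.ofReal
      (96 * (∫ s in 0..t, M s) * Real.exp (16 * ∫ s in 0..t, M s)) := by
  refine (bmoNorm_le_of_forall (hb.continuous_log_deriv_flow hc hφ ht) fun a c hac =>
    hb.integral_abs_log_deriv_flow_sub_le hφ hc hx hM0 hM hbmo ht hac).trans (le_of_eq ?_)
  congr 1
  ring

end RegularField

/-! ### Measurability in time of the BMO seminorm. -/

/-- The mean oscillation of `f` over the interval from `p.1` to `p.2`, in the parameter of the
unit interval. -/
noncomputable def unitOsc (f : ℝ → ℝ) (p : ℝ × ℝ) : ℝ :=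
  ∫ u in (0 : ℝ)..1, |f (p.1 + u * (p.2 - p.1)) - ∫ v in (0 : ℝ)..1, f (p.1 + v * (p.2 - p.1))|

theorem integral_div_eq_unit (f : ℝ → ℝ) {a c : ℝ} (hac : a < c) :
    (∫ x in a..c, f x) / (c - a) = ∫ u in (0 : ℝ)..1, f (a + u * (c - a)) := by
  have h := intervalIntegral.integral_comp_add_mul f (sub_pos.2 hac).ne' a (a := 0) (b := 1)
  simp only [mul_zero, add_zero, mul_one, add_sub_cancel, smul_eq_mul] at h
  rw [div_eq_inv_mul, ← h]
  simp only [mul_comm]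

theorem unitOsc_eq (f : ℝ → ℝ) {a c : ℝ} (hac : a < c) :
    unitOsc f (a, c) = (∫ x in a..c, |f x - intervalMean f a c|) / (c - a) := by
  rw [integral_div_eq_unit (fun x => |f x - intervalMean f a c|) hac, intervalMean,
    integral_div_eq_unit f hac, unitOsc]

theorem continuous_unitOsc {f : ℝ → ℝ} (hf : Continuous f) : Continuous (unitOsc f) := by
  have h1 : Continuous fun p : ℝ × ℝ => ∫ v in (0 : ℝ)..1, f (p.1 + v * (p.2 - p.1)) :=
    intervalIntegral.continuous_parametric_intervalIntegral_of_continuous' (by fun_prop) 0 1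
  exact intervalIntegral.continuous_parametric_intervalIntegral_of_continuous'
    (f := fun p : ℝ × ℝ => fun u => |f (p.1 + u * (p.2 - p.1)) -
      ∫ v in (0 : ℝ)..1, f (p.1 + v * (p.2 - p.1))|) (by fun_prop) 0 1

/-- Mean oscillation depends continuously on the endpoints, so rational endpoints suffice. A
countable supremum is what gives measurability in time. -/
theorem bmoNorm_eq_iSup_rat {f : ℝ → ℝ} (hf : Continuous f) :
    bmoNorm f = ⨆ (p : ℚ × ℚ) (_ : p.1 < p.2), ENNReal.ofReal (unitOsc f (p.1, p.2)) := by
  apply le_antisymm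
  · refine iSup₂_le fun a c => iSup_le fun hac => ?_
    rw [lintegral_osc_eq hf hac, ← unitOsc_eq f hac]
    refine le_of_forall_lt fun r hr => ?_
    have hcont : Continuous fun p : ℝ × ℝ => ENNReal.ofReal (unitOsc f p) :=
      ENNReal.continuous_ofReal.comp (continuous_unitOsc hf)
    have hopen : IsOpen ({p : ℝ × ℝ | r < ENNReal.ofReal (unitOsc f p)} ∩ {p | p.1 < p.2}) :=
      (isOpen_lt continuous_const hcont).inter (isOpen_lt continuous_fst continuous_snd)
    obtain ⟨p, hp1, hp2⟩ := (Rat.denseRange_cast (𝕜 := ℝ)).prodMap (Rat.denseRange_cast (𝕜 := ℝ))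
      |>.exists_mem_open hopen ⟨(a, c), hr, hac⟩
    refine lt_of_lt_of_le hp1 (le_iSup₂_of_le p ?_ le_rfl)
    have hp3 : (p.1 : ℝ) < p.2 := hp2
    exact_mod_cast hp3
  · refine iSup₂_le fun p hp => ?_
    have hp' : (p.1 : ℝ) < p.2 := by exact_mod_cast hp
    rw [unitOsc_eq f hp', ← lintegral_osc_eq hf hp']
    exact le_iSup₂_of_le (p.1 : ℝ) (p.2 : ℝ) (le_iSup_of_le hp' le_rfl)

theorem measurable_unitInterval_integral {F : ℝ → ℝ → ℝ}
    (hF : Measurable fun p : ℝ × ℝ => F p.1 p.2) :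
    Measurable fun t => ∫ u in (0 : ℝ)..1, F t u := by
  simp only [intervalIntegral.integral_of_le zero_le_one]
  exact (hF.stronglyMeasurable.integral_prod_right
    (ν := (volume : Measure ℝ).restrict (Ioc 0 1))).measurable

theorem measurable_bmoNorm {F : ℝ → ℝ → ℝ} (hF : Measurable fun p : ℝ × ℝ => F p.1 p.2)
    (hc : ∀ t, Continuous (F t)) : Measurable fun t => bmoNorm (F t) := by
  simp only [fun t => bmoNorm_eq_iSup_rat (hc t)]
  refine Measurable.iSup fun p => Measurable.iSup fun hp => ENNReal.measurable_ofReal.comp ?_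
  have h1 : Measurable fun q : ℝ × ℝ => F q.1 ((p.1 : ℝ) + q.2 * ((p.2 : ℝ) - p.1)) :=
    hF.comp (f := fun q : ℝ × ℝ => (q.1, (p.1 : ℝ) + q.2 * ((p.2 : ℝ) - p.1))) (by fun_prop)
  have h2 := measurable_unitInterval_integral
    (F := fun t u => F t ((p.1 : ℝ) + u * ((p.2 : ℝ) - p.1))) h1
  exact measurable_unitInterval_integral
    (F := fun t u => |F t ((p.1 : ℝ) + u * ((p.2 : ℝ) - p.1)) -
      ∫ v in (0 : ℝ)..1, F t ((p.1 : ℝ) + v * ((p.2 : ℝ) - p.1))|)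
    (h1.sub (h2.comp measurable_fst)).abs

/-! ### Reduction to a regular field. -/

theorem enorm_le_iSup_rat {f : ℝ → ℝ} (hf : Continuous f) (x : ℝ) :
    ‖f x‖ₑ ≤ ⨆ q : ℚ, ‖f q‖ₑ := by
  have hcl : IsClosed {x | ‖f x‖ₑ ≤ ⨆ q : ℚ, ‖f q‖ₑ} :=
    isClosed_le hf.enorm continuous_const
  exact (Rat.denseRange_cast (𝕜 := ℝ)).induction_on x hcl fun q =>
    le_iSup (fun q : ℚ => ‖f q‖ₑ) q

/-- The points where the bound holds form a closed set of full measure, hence a dense one. -/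
theorem enorm_le_eLpNorm_top {f : ℝ → ℝ} (hf : Continuous f) (x : ℝ) :
    ‖f x‖ₑ ≤ eLpNorm f ∞ volume := by
  rw [eLpNorm_exponent_top]
  have hcl : IsClosed {x | ‖f x‖ₑ ≤ eLpNormEssSup f volume} :=
    isClosed_le hf.enorm continuous_const
  have hd := Measure.dense_of_ae (ae_le_eLpNormEssSup (f := f) (μ := volume))
  have : x ∈ closure {x | ‖f x‖ₑ ≤ eLpNormEssSup f volume} := hd x
  rwa [hcl.closure_eq] at this

/-- Modification on a null set of times, and extension by zero, to a `C¹` field that is measurable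
in time. -/
theorem MemL1C1.exists_measurable_contDiff {T : ℝ} {b : ℝ → ℝ → ℝ} (h : MemL1C1 T b) :
    ∃ b₁ : ℝ → ℝ → ℝ, (∀ x, Measurable fun t => b₁ t x) ∧ (∀ t, ContDiff ℝ 1 (b₁ t)) ∧
      (∀ t ∉ Icc 0 T, b₁ t = 0) ∧ ∀ᵐ t ∂volume.restrict (Icc 0 T), b t = b₁ t := by
  set μ := (volume : Measure ℝ).restrict (Icc 0 T) with hμ
  have hmk : ∀ᵐ t ∂μ, ∀ q : ℚ, b t q = (h.aemeasurable q).mk _ t :=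
    ae_all_iff.2 fun q => (h.aemeasurable q).ae_eq_mk
  obtain ⟨S, hS, hSm, hSsub⟩ : ∃ S : Set ℝ, S ∈ ae μ ∧ MeasurableSet S ∧
      S ⊆ {t | ContDiff ℝ 1 (b t) ∧ (∀ q : ℚ, b t q = (h.aemeasurable q).mk _ t) ∧
        t ∈ Icc 0 T} := by
    have hall : ∀ᵐ t ∂μ, ContDiff ℝ 1 (b t) ∧ (∀ q : ℚ, b t q = (h.aemeasurable q).mk _ t) ∧
        t ∈ Icc 0 T := by
      filter_upwards [h.contDiff, hmk, ae_restrict_mem measurableSet_Icc] with t h1 h2 h3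
      exact ⟨h1, h2, h3⟩
    obtain ⟨N, hN, hNm, hN0⟩ := exists_measurable_superset_of_null (ae_iff.1 hall)
    exact ⟨Nᶜ, by rw [mem_ae_iff, compl_compl, hN0], hNm.compl, fun t ht => by
      by_contra hcon; exact ht (hN hcon)⟩
  classical
  set b₁ : ℝ → ℝ → ℝ := fun t => if t ∈ S then b t else 0 with hb₁
  have hcd : ∀ t, ContDiff ℝ 1 (b₁ t) := by
    intro t
    by_cases ht : t ∈ S
    · simpa only [hb₁, if_pos ht] using (hSsub ht).1
    · simp only [hb₁, if_neg ht]; exact contDiff_const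
  have hq : ∀ q : ℚ, Measurable fun t => b₁ t q := by
    intro q
    have : (fun t => b₁ t q) = S.indicator ((h.aemeasurable q).mk _) := by
      ext t
      by_cases ht : t ∈ S
      · simp only [hb₁, if_pos ht, indicator_of_mem ht]; exact (hSsub ht).2.1 q
      · simp only [hb₁, if_neg ht, indicator_of_notMem ht, Pi.zero_apply]
    rw [this]
    exact (h.aemeasurable q).measurable_mk.indicator hSm
  refine ⟨b₁, fun x => ?_, hcd, fun t ht => ?_, ?_⟩
  · obtain ⟨u, -, -, hu⟩ := (Rat.denseRange_cast (𝕜 := ℝ)).exists_seq_strictMono_tendsto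
      Rat.cast_mono x
    exact measurable_of_tendsto_metrizable (fun n => hq (u n))
      (tendsto_pi_nhds.2 fun t => ((hcd t).continuous.tendsto x).comp hu)
  · exact if_neg fun hS' => ht (hSsub hS').2.2
  · filter_upwards [hS] with t ht
    exact (if_pos ht).symm

theorem MemL1C1.exists_regularField {T : ℝ} {b : ℝ → ℝ → ℝ} (h : MemL1C1 T b)
    (hfin : ∫⁻ t in Icc 0 T, eLpNorm (deriv (b t)) ∞ volume < ∞) :
    ∃ (b' : ℝ → ℝ → ℝ) (L : ℝ → ℝ), RegularField b' L ∧
      ∀ᵐ t ∂volume.restrict (Icc 0 T), b t = b' t := by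
  obtain ⟨b₁, hm, hcd, hout, hae⟩ := h.exists_measurable_contDiff
  -- By continuity the supremum over the rationals is the full supremum, and it is visibly
  -- measurable in `t`.
  set ℓ : ℝ → ℝ≥0∞ := fun t => ⨆ q : ℚ, ‖deriv (b₁ t) q‖ₑ with hℓ
  have hdm := measurable_deriv_prod_of_contDiff hm hcd
  have hcont : ∀ t, Continuous (deriv (b₁ t)) := fun t => (hcd t).continuous_deriv le_rfl
  have hℓm : Measurable ℓ := Measurable.iSup fun q =>
    (hdm.comp (measurable_id.prodMk measurable_const)).enorm
  have hℓfin : ∫⁻ t in Icc 0 T, ℓ t < ∞ := by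
    refine lt_of_le_of_lt (lintegral_mono_ae ?_) hfin
    filter_upwards [hae] with t ht
    rw [ht]
    exact iSup_le fun q => enorm_le_eLpNorm_top (hcont t) q
  have hℓout : ∀ t ∉ Icc 0 T, ℓ t = 0 := by
    intro t ht
    have h0 : deriv (b₁ t) = 0 := by rw [hout t ht]; ext x; simp
    simp [hℓ, h0]
  have hfinset : MeasurableSet {t | ℓ t < ∞} := measurableSet_lt hℓm measurable_const
  classical
  -- Setting the field to zero at the null set of times where `ℓ` is infinite makes the derivative
  -- bound hold at every time.
  set b' : ℝ → ℝ → ℝ := fun t => if ℓ t < ∞ then b₁ t else 0 with hb'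
  have hae' : ∀ᵐ t ∂volume.restrict (Icc 0 T), b t = b' t := by
    filter_upwards [hae, ae_lt_top hℓm hℓfin.ne] with t h1 h2
    simp only [hb', if_pos h2, h1]
  have hm' : ∀ x, Measurable fun t => b' t x := by
    intro x
    have : (fun t => b' t x) = fun t => if ℓ t < ∞ then b₁ t x else 0 := by
      ext t; simp only [hb']; split_ifs <;> rfl
    rw [this]
    exact Measurable.ite hfinset (hm x) measurable_const
  refine ⟨b', fun t => (ℓ t).toReal, ⟨hm', fun t => ?_, fun t x => ?_, ?_, ?_⟩, hae'⟩
  · by_cases ht : ℓ t < ∞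
    · simpa only [hb', if_pos ht] using hcd t
    · simp only [hb', if_neg ht]; exact contDiff_const
  · by_cases ht : ℓ t < ∞
    · simp only [hb', if_pos ht]
      have h1 := ENNReal.toReal_mono ht.ne (enorm_le_iSup_rat (hcont t) x)
      simpa using h1
    · simp only [hb', if_neg ht]
      have h0 : deriv (0 : ℝ → ℝ) x = 0 := by simp
      rw [h0, abs_zero]
      exact ENNReal.toReal_nonneg
  · have h1 : IntegrableOn (fun t => (ℓ t).toReal) (Icc 0 T) :=
      integrable_toReal_of_lintegral_ne_top hℓm.aemeasurable hℓfin.ne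
    exact h1.integrable_of_forall_notMem_eq_zero fun t ht => by simp [hℓout t ht]
  · have h1 : IntegrableOn (fun t => b' t 0) (Icc 0 T) := by
      refine ⟨(hm' 0).aestronglyMeasurable, lt_of_le_of_lt (lintegral_mono_ae ?_)
        (h.lintegral_lt_top 0)⟩
      filter_upwards [hae'] with t ht
      rw [← ht]
      exact le_iSup₂_of_le (0 : ℝ) (by simp) le_self_add
    refine h1.integrable_of_forall_notMem_eq_zero fun t ht => ?_
    simp only [hb', hout t ht]
    split_ifs <;> rfl

theorem IsFlow.congr_ae {T : ℝ} {b b' φ : ℝ → ℝ → ℝ} (hT : 0 ≤ T)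
    (hae : ∀ᵐ t ∂volume.restrict (Icc 0 T), b t = b' t) (h : IsFlow T b φ) : IsFlow T b' φ := by
  have hae' : ∀ᵐ s, s ∈ Icc 0 T → b s = b' s := (ae_restrict_iff' measurableSet_Icc).1 hae
  intro x
  refine ⟨(h x).1.congr_ae ?_, fun t ht => ?_⟩
  · rw [EventuallyEq, ae_restrict_iff' measurableSet_uIoc]
    filter_upwards [hae'] with s hs hs'
    rw [uIoc_of_le hT] at hs'
    rw [hs ⟨hs'.1.le, hs'.2⟩]
  · rw [(h x).2 t ht]
    congr 1
    apply intervalIntegral.integral_congr_ae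
    filter_upwards [hae'] with s hs hs'
    rw [uIoc_of_le ht.1] at hs'
    rw [hs ⟨hs'.1.le, hs'.2.trans ht.2⟩]

/-! ### Conclusion. -/

theorem theorem3p1 :
    ∃ C₆ C₇ : ℝ, 0 < C₆ ∧ 0 < C₇ ∧
      ∀ (T : ℝ) (b : ℝ → ℝ → ℝ), 0 < T → MemL1C1 T b →
        (∫⁻ t in Icc 0 T, eLpNorm (deriv (b t)) ∞ volume) < ∞ →
        ∃ φ : ℝ → ℝ → ℝ, IsFlow T b φ ∧
          (∀ ψ : ℝ → ℝ → ℝ, IsFlow T b ψ → ∀ t ∈ Icc 0 T, ∀ x : ℝ, ψ t x = φ t x) ∧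
          ∀ t ∈ Icc 0 T,
            (∀ x : ℝ, DifferentiableAt ℝ (φ t) x ∧ deriv (φ t) x ≠ 0) ∧
            LocallyIntegrable (fun x => Real.log |deriv (φ t) x|) volume ∧
            (∫⁻ s in Icc 0 t, bmoNorm (deriv (b s))) < ∞ ∧
            bmoNorm (fun x => Real.log |deriv (φ t) x|) ≤
              ENNReal.ofReal
                (C₆ * (∫⁻ s in Icc 0 t, bmoNorm (deriv (b s))).toReal *
                  Real.exp (C₇ * (∫⁻ s in Icc 0 t, bmoNorm (deriv (b s))).toReal)) := by
  -- `96 = 2 · 48`, the doubling coming from the change of centre to the mean; 16 is the Grönwall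
  -- rate inherited from John–Nirenberg.
  refine ⟨96, 16, by norm_num, by norm_num, fun T b hT hmem hfin => ?_⟩
  obtain ⟨b', L, hb, hae⟩ := hmem.exists_regularField hfin
  obtain ⟨φ, hφ, hc, hx⟩ := hb.exists_isFlow hT
  have hae_symm : ∀ᵐ t ∂volume.restrict (Icc 0 T), b' t = b t := hae.mono fun _ h => h.symm
  refine ⟨φ, hφ.congr_ae hT.le hae_symm, fun ψ hψ t ht x =>
    hb.isFlow_unique hT.le hφ (hψ.congr_ae hT.le hae) ht x, fun t ht => ?_⟩
  have hder := hb.hasDerivAt_flow hc hφ ht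
  have hlog : (fun x => Real.log |deriv (φ t) x|) = fun x =>
      ∫ s in 0..t, deriv (b' s) (φ s x) := by
    ext x
    rw [(hder x).deriv, Real.abs_exp, Real.log_exp]
  have hbmo_le : ∀ s, bmoNorm (deriv (b' s)) ≤ ENNReal.ofReal (2 * L s) := fun s =>
    bmoNorm_le_of_abs_le (hb.continuous_deriv s) (hb.abs_deriv_le s)
  have hbmo_ne : ∀ s, bmoNorm (deriv (b' s)) ≠ ∞ := fun s =>
    ne_top_of_le_ne_top ENNReal.ofReal_ne_top (hbmo_le s)
  have hbmo_meas : Measurable fun s => bmoNorm (deriv (b' s)) :=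
    measurable_bmoNorm hb.measurable_deriv_prod hb.continuous_deriv
  have hint : ∫⁻ s in Icc 0 t, bmoNorm (deriv (b s)) =
      ∫⁻ s in Icc 0 t, bmoNorm (deriv (b' s)) := by
    apply lintegral_congr_ae
    filter_upwards [ae_restrict_of_ae_restrict_of_subset (Icc_subset_Icc_right ht.2) hae]
      with s hs
    rw [hs]
  have hMint : Integrable fun s => (bmoNorm (deriv (b' s))).toReal := by
    refine (hb.integrable_bound.const_mul 2).mono'
      hbmo_meas.ennreal_toReal.aestronglyMeasurable (Eventually.of_forall fun s => ?_)
    rw [Real.norm_eq_abs, abs_of_nonneg ENNReal.toReal_nonneg]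
    exact ENNReal.toReal_le_of_le_ofReal (mul_nonneg zero_le_two (hb.bound_nonneg s)) (hbmo_le s)
  have hBeq : ∫ s in 0..t, (bmoNorm (deriv (b' s))).toReal =
      (∫⁻ s in Icc 0 t, bmoNorm (deriv (b s))).toReal := by
    rw [hint, intervalIntegral.integral_of_le ht.1, ← integral_Icc_eq_integral_Ioc]
    exact integral_toReal hbmo_meas.aemeasurable
      (Eventually.of_forall fun s => (hbmo_ne s).lt_top)
  have hbound := hb.bmoNorm_log_deriv_flow_le hφ hc hx (fun _ => ENNReal.toReal_nonneg) hMint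
    (fun s => (ENNReal.ofReal_toReal (hbmo_ne s)).ge) ht
  rw [hBeq] at hbound
  refine ⟨fun x => ⟨(hder x).differentiableAt, ?_⟩, ?_, ?_, ?_⟩
  · rw [(hder x).deriv]; exact (Real.exp_pos _).ne'
  · rw [hlog]; exact (hb.continuous_log_deriv_flow hc hφ ht).locallyIntegrable
  · rw [hint]
    refine lt_of_le_of_lt (lintegral_mono fun s => hbmo_le s) ?_
    exact (hb.integrable_bound.const_mul 2).restrict.lintegral_lt_top
  · rwa [hlog]
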